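/- Let $a,b,c,d$ be positive integers, let $V=\{(x,y,z)\in\mathbb C^3 : y^a=z^bx^c+x^d\}$, and let $Oz=\{x=y=0\}\subset V$ be the $z$-axis. Identify $\mathbb C^3$ with Euclidean $\mathbb R^6$, and consider the filtration $S^4=V\supset S^3=S^2=Oz$ (indexed by real dimension), whose nonempty layers are $V\setminus Oz$ and $Oz$. Fix a real number $\gamma>1$. Let $l\le m$, let $\Omega\subset\mathbb R^n$ be open, and let $S^m\supset S^{m-1}\supset\dots\supset S^l\ne\emptyset$ be subsets of $\Omega$ that are closed in $\Omega$ and subanalytic in $\Omega$, such that each $\mathring S^j=S^j\setminus S^{j-1}$ (with $S^{l-1}=\emptyset$) is a smooth submanifold of pure dimension $j$ or empty. Put $d_j(q)=\operatorname{dist}(q,S^j)$ for $l\le j\le m$ and $d_{l-1}\equiv 1$. For $q\in\mathring S^j$ let $P_q:\mathbb R^n\to T_q\mathring S^j$ be the orthogonal projection (regarded as an operator on $\mathbb R^n$) and $P_q^\perp=I-P_q$. A chain of $q\in\mathring S^{j_1}$ consists of indices $j_1>j_2>\dots>j_r=l$, where for $s\ge2$ the index $j_s$ is the largest integer $i$ with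 $l\le i<j_{s-1}$ and $d_{i-1}(q)\ge 2\gamma^2 d_{i}(q)$, together with points $q_{j_1}=q$ and $q_{j_s}\in\mathring S^{j_s}$ with $|q-q_{j_s}|\le\gamma d_{j_s}(q)$. The filtration is a Lipschitz stratification in the sense of Mostowski if there is a constant $C>0$ such that for every chain $q=q_{j_1},\dots,q_{j_r}$, every $k$ with $2\le k\le r$, and every $q'\in\mathring S^{j_1}$ with $|q-q'|\le\frac1{2\gamma}d_{j_1-1}(q)$, $$|P_q^\perp P_{q_{j_2}}\cdots P_{q_{j_k}}|\le \frac{C|q-q_{j_2}|}{d_{j_k-1}(q)},\qquad |(P_q-P_{q'})P_{q_{j_2}}\cdots P_{q_{j_k}}|\le \frac{C|q-q'|}{d_{j_k-1}(q)},$$ and, for every chain (including those with $r=1$) and every such $q'$, $$|P_q-P_{q'}|\le \frac{C|q-q'|}{d_{j_1-1}(q)}.$$ Then the germ at $0$ of the two-stratum stratification $(V\setminus Oz,\,Oz)$ is a Lipschitz stratification in the sense of Mostowski, that is, there is an open neighbourhood $\Omega$ of $0$ in $\mathbb C^3$ such that the filtration $S^4\cap\Omega\supset S^3\cap\Omega\supset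 S^2\cap\Omega$ is a Lipschitz stratification, if and only if $a=1$ or $d\le c$. -/

import Mathlib

open Set Topology
open scoped ContDiff

noncomputable section

namespace Mostowski

section Subanalytic

variable {F : Type*} [NormedAddCommGroup F] [NormedSpace ℝ F]

/-- `A` is semianalytic in `F`: near each point of `F` it is a finite union of sets, each described
by finitely many equations and strict inequalities between real analytic functions. -/
def IsSemianalytic (A : Set F) : Prop :=
  ∀ p : F, ∃ W : Set F, IsOpen W ∧ p ∈ W ∧
    ∃ (N M : ℕ) (f g : Fin N → Fin M → F → ℝ),
      (∀ i k, AnalyticOnNhd ℝ (f i k) W ∧ AnalyticOnNhd ℝ (g i k) W) ∧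
      A ∩ W = {x | x ∈ W ∧ ∃ i, ∀ k, f i k x = 0 ∧ 0 < g i k x}

/-- `A` is a subanalytic subset of the open set `Ω`: each point of `Ω` has a neighbourhood in which
`A` is the projection of a bounded semianalytic set in the product with some `ℝᵏ`. -/
def IsSubanalyticIn (Ω A : Set F) : Prop :=
  A ⊆ Ω ∧ ∀ p ∈ Ω, ∃ W : Set F, IsOpen W ∧ p ∈ W ∧
    ∃ (k : ℕ) (B : Set (F × EuclideanSpace ℝ (Fin k))),
      IsSemianalytic B ∧ Bornology.IsBounded B ∧ A ∩ W = Prod.fst '' B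

end Subanalytic

variable {E : Type*} [NormedAddCommGroup E] [InnerProductSpace ℝ E] [FiniteDimensional ℝ E]

/-- `M` is an (embedded) smooth submanifold of `E`, of pure dimension `j`, or empty: near each of
its points it is the zero set of a smooth submersion onto `ℝᵏ` with `j + k = dim E`. -/
def IsSmoothSubmanifold (j : ℕ) (M : Set E) : Prop :=
  ∀ p ∈ M, ∃ W : Set E, IsOpen W ∧ p ∈ W ∧
    ∃ (k : ℕ) (Φ : E → EuclideanSpace ℝ (Fin k)), j + k = Module.finrank ℝ E ∧
      ContDiffOn ℝ ∞ Φ W ∧ (∀ x ∈ W, Function.Surjective (fderiv ℝ Φ x)) ∧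
      M ∩ W = {x | x ∈ W ∧ Φ x = 0}

/-- The tangent space `T_q M`. For a smooth submanifold `M` the tangent cone is already a
linear subspace, and the span serves only to bundle it as such. -/
def tangentSpaceAt (M : Set E) (q : E) : Submodule ℝ E :=
  Submodule.span ℝ (tangentConeAt ℝ M q)

/-- The orthogonal projection `P_q : E → T_q M`, as an operator on `E`. -/
def tangentProj (M : Set E) (q : E) : E →L[ℝ] E :=
  (tangentSpaceAt M q).starProjection

/-- `S̊ʲ = Sʲ \ Sʲ⁻¹`, where `Sˡ⁻¹ = ∅`. -/
def layer (l : ℕ) (S : ℕ → Set E) (j : ℕ) : Set E :=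
  if j = l then S j else S j \ S (j - 1)

/-- The function `d_{j-1}`: the distance to `Sʲ⁻¹`, with the convention `d_{l-1} = 1`. -/
def distBelow (l : ℕ) (S : ℕ → Set E) (j : ℕ) (q : E) : ℝ :=
  if j = l then 1 else Metric.infDist q (S (j - 1))

/-- `Sᵐ ⊇ Sᵐ⁻¹ ⊇ ⋯ ⊇ Sˡ ≠ ∅` is a stratification of `Sᵐ`, a closed subanalytic subset of the
open set `Ω`. Only the values `S j` with `l ≤ j ≤ m` matter. -/
structure IsStratification (Ω : Set E) (l m : ℕ) (S : ℕ → Set E) : Prop where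
  isOpen : IsOpen Ω
  le : l ≤ m
  nonempty : (S l).Nonempty
  mono : ∀ j, l ≤ j → j < m → S j ⊆ S (j + 1)
  closed : ∀ j, l ≤ j → j ≤ m → ∃ K : Set E, IsClosed K ∧ S j = K ∩ Ω
  subanalytic : ∀ j, l ≤ j → j ≤ m → IsSubanalyticIn Ω (S j)
  smooth : ∀ j, l ≤ j → j ≤ m → IsSmoothSubmanifold j (layer l S j)

/-- The points `q 0, …, q r`, with indices `j 0 > ⋯ > j r = l`, form a chain of the point `q 0`
(numbered from `0`). -/
structure IsChain (γ : ℝ) (l m : ℕ) (S : ℕ → Set E) (r : ℕ) (j : ℕ → ℕ) (q : ℕ → E) : Prop where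
  start_mem : l ≤ j 0 ∧ j 0 ≤ m
  step : ∀ s < r, IsGreatest
    {i | l ≤ i ∧ i < j s ∧ 2 * γ ^ 2 * Metric.infDist (q 0) (S i) ≤ distBelow l S i (q 0)}
    (j (s + 1))
  last : j r = l
  mem : ∀ s ≤ r, q s ∈ layer l S (j s)
  near : ∀ s, 1 ≤ s → s ≤ r → dist (q 0) (q s) ≤ γ * Metric.infDist (q 0) (S (j s))

/-- The projection `P_x : E → T_x S̊ⁱ` at a point `x` of the layer of index `i`. -/
def stratumProj (l : ℕ) (S : ℕ → Set E) (i : ℕ) (x : E) : E →L[ℝ] E :=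
  tangentProj (layer l S i) x

/-- The composite `P_{q 1} ∘ P_{q 2} ∘ ⋯ ∘ P_{q k}` along a chain. -/
def chainProj (l : ℕ) (S : ℕ → Set E) (j : ℕ → ℕ) (q : ℕ → E) : ℕ → (E →L[ℝ] E)
  | 0 => ContinuousLinearMap.id ℝ E
  | k + 1 => (chainProj l S j q k).comp (stratumProj l S (j (k + 1)) (q (k + 1)))

/-- Lipschitz stratification in the sense of Mostowski, with fixed constant `γ > 1`: the three
bounds hold for all chains with one constant `C`. -/
def IsLipschitzStratification (γ : ℝ) (Ω : Set E) (l m : ℕ) (S : ℕ → Set E) : Prop :=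
  IsStratification Ω l m S ∧
  ∃ C : ℝ, 0 < C ∧ ∀ (r : ℕ) (j : ℕ → ℕ) (q : ℕ → E), IsChain γ l m S r j q →
    (∀ k, 1 ≤ k → k ≤ r →
      ‖(ContinuousLinearMap.id ℝ E - stratumProj l S (j 0) (q 0)).comp (chainProj l S j q k)‖
        ≤ C * dist (q 0) (q 1) / distBelow l S (j k) (q 0)) ∧
    ∀ q' ∈ layer l S (j 0), dist (q 0) q' ≤ 1 / (2 * γ) * distBelow l S (j 0) (q 0) →
      (∀ k, 1 ≤ k → k ≤ r →
        ‖(stratumProj l S (j 0) (q 0) - stratumProj l S (j 0) q').comp (chainProj l S j q k)‖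
          ≤ C * dist (q 0) q' / distBelow l S (j k) (q 0)) ∧
      ‖stratumProj l S (j 0) (q 0) - stratumProj l S (j 0) q'‖
        ≤ C * dist (q 0) q' / distBelow l S (j 0) (q 0)

/-- The filtration `S` defines a Lipschitz stratification as a germ at `p`: it does so after
restriction to some open neighbourhood of `p`. -/
def IsLipschitzStratificationGerm (γ : ℝ) (p : E) (l m : ℕ) (S : ℕ → Set E) : Prop :=
  ∃ Ω : Set E, IsOpen Ω ∧ p ∈ Ω ∧ IsLipschitzStratification γ Ω l m (fun j => S j ∩ Ω)

/-- `ℂ³` with its Hermitian norm, i.e. Euclidean `ℝ⁶`; the coordinates of `p` are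
`x = p 0`, `y = p 1`, `z = p 2`. -/
abbrev C3 : Type := EuclideanSpace ℂ (Fin 3)

/-- The complex surface `y ^ a = z ^ b * x ^ c + x ^ d`. -/
def surface (a b c d : ℕ) : Set C3 :=
  {p | p 1 ^ a = p 2 ^ b * p 0 ^ c + p 0 ^ d}

/-- The complex `z`-axis `Oz`. -/
def zAxis : Set C3 := {p | p 0 = 0 ∧ p 1 = 0}

/-- The filtration with `S⁴ = V` and `S³ = S² = Oz` (indexed by real dimension), whose only
nonempty layers are `V \ Oz` and `Oz`. -/
def surfaceFiltration (a b c d : ℕ) (j : ℕ) : Set C3 :=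
  if j = 4 then surface a b c d else zAxis

end Mostowski

end

/-!
Let `f = y ^ a - z ^ b x ^ c - x ^ d`. Off the axis the surface `V = {f = 0}` is, wherever its
gradient is nonzero, a regular level set, so that its tangent space is the complex plane orthogonal
to the conjugate gradient (`tangentSpaceAt_eq_ker`). Since the layer of index `3` is empty, the only
chains with a nontrivial condition consist of a point `q` off the axis and a nearby point of the
axis (`IsChain.cases`). With `δ` the distance to the axis, the definition therefore asks, for `q`
and `q'` in `V \ Oz` with `|q - q'| ≤ δ(q) / (2 γ)`, that
`|P_q^⊥ e| ≤ C δ`, `|(P_q - P_q') e| ≤ C |q - q'|` and `|P_q - P_q'| ≤ C |q - q'| / δ`,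
where `e` is the unit vector along the axis.

*Sufficiency.* Suppose a Lipschitz vector field `n` on `ℂ³` is parallel to the gradient along
`V \ Oz`, satisfies `|n| ≥ κ (|x| + |y|)`, and has `z`-component `x m` with `m` Lipschitz and zero
on the axis. Then `|n_z| = O(δ²)` and `|n_z(q) - n_z(q')| = O(δ |q - q'|)`, and the three bounds
follow from the formula `P^⊥ v = ⟪N, v⟫ N / |N|²`, with `N` the conjugate of `n`, and from the
identity `|N / |N|² - N' / |N'|²| = |N - N'| / (|N| |N'|)`; see
`isLipschitzStratificationGerm_of_normalField`. For `a = 1` one takes `n = x ∇f`. For `d ≤ c` the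
equation reads `y ^ a = x ^ d (1 + t)` with `t = z ^ b x ^ (c - d)`, and on `V` the field
`(x y / x ^ d) ∇f` equals the polynomial field
`(-y (d + c t), a x (1 + t), -b x y z ^ (b - 1) x ^ (c - d))`.

*Necessity.* If `a ≥ 2` and `c < d`, then `V` contains the points with `y = 0` and
`z ^ b = -x ^ (d - c)`, where `f_y = 0` and `|f_z| / |f_x|` is a multiple of `|x| / |z|`, whereas
`δ = |x|`. The first bound becomes `b ≤ C ((c + d) |z| + b |x|)` (`le_of_chain_bound`), which fails
as such points tend to the origin.
-/

noncomputable section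

namespace Mostowski

/-! ### Regular level sets -/

section LevelSets

variable {E G : Type*} [NormedAddCommGroup E] [InnerProductSpace ℝ E]
  [NormedAddCommGroup G] [NormedSpace ℝ G]

/-- Tangent vectors to a set on which `f` vanishes are killed by the derivative of `f`. -/
theorem tangentSpaceAt_le_ker {f : E → G} {f' : E →L[ℝ] G} {q : E} {M : Set E}
    (hf : HasFDerivAt f f' q) (hM : ∀ᶠ x in 𝓝[M] q, f x = 0) (hq : f q = 0) :
    tangentSpaceAt M q ≤ f'.ker := by
  refine Submodule.span_le.2 fun v hv => ?_
  have hv' : v ∈ tangentConeAt ℝ {x | f x = 0} q :=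
    tangentConeAt_mono_nhds (nhdsWithin_le_iff.2 hM) hv
  have h := hf.hasFDerivWithinAt.mapsTo_tangent_cone hv'
  have h0 : f '' {x | f x = 0} ⊆ {0} := by rintro _ ⟨x, hx, rfl⟩; exact hx
  have h1 := tangentConeAt_mono h0 h
  have h2 := tangentConeAt_subset_zero (𝕜 := ℝ) (s := ({0} : Set G)) (x := f q)
    (by rw [accPt_iff_frequently]; simp [hq]) h1
  simpa using h2

variable [FiniteDimensional ℝ G]

/-- The tangent space of a regular level set is the kernel of the derivative: by the implicit
function theorem every vector of the kernel is the velocity of a curve in the level set. -/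
theorem tangentSpaceAt_eq_ker [FiniteDimensional ℝ E] {f : E → G} {f' : E →L[ℝ] G} {q : E}
    {M : Set E} (hf : HasStrictFDerivAt f f' q) (hsurj : Function.Surjective f')
    (hM : ∀ᶠ x in 𝓝 q, x ∈ M ↔ f x = 0) (hq : f q = 0) :
    tangentSpaceAt M q = f'.ker := by
  have := FiniteDimensional.complete ℝ E
  refine le_antisymm (tangentSpaceAt_le_ker hf.hasFDerivAt ?_ hq) fun v hv => ?_
  · filter_upwards [nhdsWithin_le_nhds hM, self_mem_nhdsWithin] with x hx hxM using hx.1 hxM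
  · have hr : (f' : E →ₗ[ℝ] G).range = ⊤ := LinearMap.range_eq_top.2 hsurj
    set φ : f'.ker → E := hf.implicitFunction f f' hr (f q) with hφ
    have hφ' : HasStrictFDerivAt φ f'.ker.subtypeL 0 := hf.to_implicitFunction hr
    have hφ0 : φ 0 = q :=
      hf.implicitFunction_apply_image hr
    have hφf : ∀ᶠ t in 𝓝 (0 : f'.ker), f (φ t) = 0 := by
      have h := hf.map_implicitFunction_eq hr
      have hc : Filter.Tendsto (fun t : f'.ker => (f q, t)) (𝓝 0) (𝓝 (f q, 0)) :=
        (continuous_const.prodMk continuous_id).tendsto 0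
      filter_upwards [hc.eventually h] with t ht
      exact ht.trans hq
    have hφM : {t | φ t ∈ M} ∈ 𝓝 (0 : f'.ker) := by
      have hcont : Filter.Tendsto φ (𝓝 0) (𝓝 q) := by
        simpa only [hφ0] using hφ'.hasFDerivAt.continuousAt.tendsto
      filter_upwards [hφf, hcont.eventually hM] with t h1 h2 using h2.2 h1
    have hv' : (⟨v, hv⟩ : f'.ker) ∈ tangentConeAt ℝ {t | φ t ∈ M} 0 := by
      rw [tangentConeAt_of_mem_nhds hφM]; trivial
    have h := hφ'.hasFDerivAt.hasFDerivWithinAt.mapsTo_tangent_cone hv'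
    rw [hφ0] at h
    exact Submodule.subset_span (tangentConeAt_mono (by rintro _ ⟨t, ht, rfl⟩; exact ht) h)

/-- A set that is locally the regular zero set of a map into a space `G` is a smooth submanifold of
codimension `dim G`. -/
theorem isSmoothSubmanifold_of_levelSet {j : ℕ} {M : Set E}
    (hj : j + Module.finrank ℝ G = Module.finrank ℝ E)
    (h : ∀ p ∈ M, ∃ W : Set E, IsOpen W ∧ p ∈ W ∧ ∃ f : E → G, ContDiff ℝ ∞ f ∧
      (∀ x ∈ W, Function.Surjective (fderiv ℝ f x)) ∧ M ∩ W = {x | x ∈ W ∧ f x = 0}) :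
    IsSmoothSubmanifold j M := by
  intro p hp
  obtain ⟨W, hW, hpW, f, hf, hs, hM⟩ := h p hp
  refine ⟨W, hW, hpW, _, fun x => toEuclidean (f x), hj,
    (toEuclidean.contDiff.comp hf).contDiffOn, fun x hx => ?_, ?_⟩
  · have : fderiv ℝ (fun x => toEuclidean (f x)) x
        = (toEuclidean : G ≃L[ℝ] _).toContinuousLinearMap.comp (fderiv ℝ f x) :=
      (toEuclidean.toContinuousLinearMap.hasFDerivAt.comp x
        (hf.differentiable (by simp) x).hasFDerivAt).fderiv
    rw [this]
    exact toEuclidean.surjective.comp (hs x hx)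
  · rw [hM]
    ext x
    simp

/-- The part in a ball of the zero set of a real analytic function is subanalytic in that ball. -/
theorem isSubanalyticIn_ball {f : E → ℝ} (hf : ContDiff ℝ ω f) (r : ℝ) :
    IsSubanalyticIn (Metric.ball 0 r) ({x | f x = 0} ∩ Metric.ball 0 r) := by
  refine ⟨inter_subset_right, fun p hp => ⟨Metric.ball 0 r, Metric.isOpen_ball, hp, 0,
    -- No auxiliary variables are needed: the product is taken with the one-point space `ℝ⁰`.
    {w | f w.1 = 0 ∧ w.1 ∈ Metric.ball 0 r}, fun p => ⟨univ, isOpen_univ, trivial, 1, 1,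
      fun _ _ w => f w.1, fun _ _ w => r - ‖w.1‖ ^ 2 / r, fun _ _ => ⟨?_, ?_⟩, ?_⟩, ?_, ?_⟩⟩
  · exact contDiff_omega_iff_analyticOnNhd.1 (hf.comp contDiff_fst)
  · exact contDiff_omega_iff_analyticOnNhd.1
      (contDiff_const.sub (((contDiff_norm_sq ℝ).comp contDiff_fst).div_const r))
  · have hr : 0 < r := Metric.pos_of_mem_ball hp
    ext w
    have : ‖w.1‖ < r ↔ ‖w.1‖ ^ 2 / r < r := by
      rw [div_lt_iff₀ hr, ← sq, sq_lt_sq₀ (norm_nonneg _) hr.le]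
    simp [this]
  · refine (Metric.isBounded_ball (x := (0 : E × EuclideanSpace ℝ (Fin 0))) (r := r)).subset ?_
    rintro ⟨x, t⟩ ⟨-, hx⟩
    have hr : 0 < r := Metric.pos_of_mem_ball hp
    simp only [mem_ball_zero_iff] at hx ⊢
    rw [Prod.norm_def, max_lt_iff]
    exact ⟨hx, by rw [Subsingleton.elim t 0]; simpa using hr⟩
  · ext x
    constructor
    · rintro ⟨h, -⟩; exact ⟨(x, 0), h, rfl⟩
    · rintro ⟨w, h, rfl⟩; exact ⟨h, h.2⟩

end LevelSets

/-! ### Orthogonal projections onto complex planes -/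

section ComplexHyperplanes

/-- The real-linear functional `v ↦ ⟪N, v⟫_ℂ` on `ℂ³`; its kernel is the complex plane with
Hermitian normal vector `N`. -/
def hermitianFunctional (N : C3) : C3 →L[ℝ] ℂ := (innerSL ℂ N).restrictScalars ℝ

@[simp]
theorem hermitianFunctional_apply (N v : C3) : hermitianFunctional N v = inner ℂ N v := rfl

theorem hermitianFunctional_surjective {N : C3} (hN : N ≠ 0) :
    Function.Surjective (hermitianFunctional N) := fun w =>
  ⟨(w / inner ℂ N N) • N, by
    rw [hermitianFunctional_apply, inner_smul_right, div_mul_cancel₀ _ (inner_self_ne_zero.2 hN)]⟩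

/-- The real orthogonal projection onto a complex plane, in terms of a Hermitian normal vector. -/
theorem starProjection_ker_hermitianFunctional {N : C3} (hN : N ≠ 0) (v : C3) :
    (hermitianFunctional N).ker.starProjection v
      = v - (inner ℂ N v / (‖N‖ : ℂ) ^ 2) • N := by
  have hN' : (‖N‖ : ℂ) ≠ 0 := by simpa using hN
  apply Submodule.eq_starProjection_of_mem_of_inner_eq_zero
  · rw [LinearMap.mem_ker]
    change inner ℂ N _ = 0
    rw [inner_sub_right, inner_smul_right, inner_self_eq_norm_sq_to_K]
    change _ - _ * ((‖N‖ : ℂ) ^ 2) = 0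
    field_simp
    ring
  · intro w hw
    have hw' : inner ℂ N w = 0 := hw
    change (inner ℂ _ w : ℂ).re = 0
    rw [sub_sub_cancel, inner_smul_left, hw', mul_zero, Complex.zero_re]

theorem norm_sub_starProjection_ker {N : C3} (hN : N ≠ 0) (v : C3) :
    ‖v - (hermitianFunctional N).ker.starProjection v‖ = ‖(inner ℂ N v : ℂ)‖ / ‖N‖ := by
  have hN' : ‖N‖ ≠ 0 := by simpa using hN
  rw [starProjection_ker_hermitianFunctional hN, sub_sub_cancel, norm_smul, norm_div, norm_pow,
    Complex.norm_real, norm_norm]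
  field_simp

/-- The variation of the projection onto a complex plane. The second summand measures the variation
of `N / ‖N‖²`, the image of the normal vector under inversion. -/
theorem norm_starProjection_ker_sub_le {N N' : C3} (hN : N ≠ 0) (hN' : N' ≠ 0) (v : C3) :
    ‖(hermitianFunctional N).ker.starProjection v - (hermitianFunctional N').ker.starProjection v‖
      ≤ ‖(inner ℂ N v - inner ℂ N' v : ℂ)‖ / ‖N'‖
        + ‖(inner ℂ N v : ℂ)‖ * (‖N - N'‖ / (‖N‖ * ‖N'‖)) := by
  have h0 : ‖N'‖ ≠ 0 := by simpa using hN'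
  have key := dist_div_norm_sq_smul hN hN' 1
  rw [dist_eq_norm, dist_eq_norm] at key
  have hsm : ∀ K : C3, ((1 / ‖K‖) ^ 2 : ℝ) • K = (((‖K‖ : ℂ) ^ 2)⁻¹ : ℂ) • K := fun K => by
    rw [← Complex.coe_smul]; simp
  rw [hsm, hsm] at key
  have hsplit : (hermitianFunctional N).ker.starProjection v
      - (hermitianFunctional N').ker.starProjection v
      = -(((inner ℂ N v - inner ℂ N' v) / (‖N'‖ : ℂ) ^ 2) • N')
        - (inner ℂ N v : ℂ) • ((((‖N‖ : ℂ) ^ 2)⁻¹ : ℂ) • N - (((‖N'‖ : ℂ) ^ 2)⁻¹ : ℂ) • N') := by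
    rw [starProjection_ker_hermitianFunctional hN, starProjection_ker_hermitianFunctional hN']
    module
  rw [hsplit]
  refine (norm_sub_le _ _).trans (le_of_eq ?_)
  rw [norm_neg, norm_smul, norm_smul, norm_div, norm_pow, Complex.norm_real, norm_norm, key]
  congr 1
  · field_simp
  · ring

/-- Coordinatewise complex conjugation of `ℂ³`. It turns the coefficients of a complex linear form
into a Hermitian normal vector of its kernel. -/
def conj3 : C3 ≃ₗᵢ[ℝ] C3 := LinearIsometryEquiv.piLpCongrRight 2 fun _ => Complex.conjLIE

@[simp]
theorem inner_conj3 (n v : C3) :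
    (inner ℂ (conj3 n) v : ℂ) = n 0 * v 0 + n 1 * v 1 + n 2 * v 2 := by
  simp [conj3, PiLp.inner_apply, Fin.sum_univ_three, mul_comm]

theorem tangentProj_eq {M : Set C3} {q : C3} {K : Submodule ℝ C3}
    (h : tangentSpaceAt M q = K) : tangentProj M q = K.starProjection := by
  subst h; rfl

theorem finrank_C3 : Module.finrank ℝ C3 = 6 := by
  rw [← Module.finrank_mul_finrank ℝ ℂ C3]
  simp

end ComplexHyperplanes

/-! ### The layers of the surface and their tangent planes -/

section Layers

variable (a b c d : ℕ) (Ω : Set C3)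

/-- The defining function of the surface. -/
def surfaceFn (p : C3) : ℂ := p 1 ^ a - (p 2 ^ b * p 0 ^ c + p 0 ^ d)

/-- The complex gradient of the defining function of the surface. -/
def surfaceGrad (p : C3) : C3 :=
  !₂[-(c * p 2 ^ b * p 0 ^ (c - 1) + d * p 0 ^ (d - 1)), a * p 1 ^ (a - 1),
    -(b * p 2 ^ (b - 1) * p 0 ^ c)]

/-- The projection of `ℂ³` to the `(x, y)`-plane, whose kernel is the `z`-axis. -/
def planeProj : C3 →L[ℝ] ℂ × ℂ :=
  ((EuclideanSpace.proj 0 : C3 →L[ℂ] ℂ).prod (EuclideanSpace.proj 1)).restrictScalars ℝ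

@[simp]
theorem planeProj_apply (p : C3) : planeProj p = (p 0, p 1) := rfl

theorem planeProj_surjective : Function.Surjective planeProj := fun w =>
  ⟨!₂[w.1, w.2, 0], by ext <;> simp⟩

theorem mem_zAxis {p : C3} : p ∈ zAxis ↔ planeProj p = 0 := by
  rw [planeProj_apply, Prod.mk_eq_zero]; rfl

theorem mem_surface {p : C3} : p ∈ surface a b c d ↔ surfaceFn a b c d p = 0 := by
  rw [surfaceFn, sub_eq_zero]; rfl

variable {a b c d Ω}

theorem layer_two : layer 2 (fun j => surfaceFiltration a b c d j ∩ Ω) 2 = zAxis ∩ Ω := by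
  simp [layer, surfaceFiltration]

theorem layer_three : layer 2 (fun j => surfaceFiltration a b c d j ∩ Ω) 3 = ∅ := by
  simp [layer, surfaceFiltration]

theorem layer_four : layer 2 (fun j => surfaceFiltration a b c d j ∩ Ω) 4
    = (surface a b c d ∩ Ω) \ (zAxis ∩ Ω) := by
  simp [layer, surfaceFiltration]

theorem contDiff_coord {n : WithTop ℕ∞} (i : Fin 3) : ContDiff ℂ n fun p : C3 => p i :=
  (EuclideanSpace.proj i : C3 →L[ℂ] ℂ).contDiff

theorem contDiff_surfaceFn {n : WithTop ℕ∞} : ContDiff ℝ n (surfaceFn a b c d) :=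
  ContDiff.restrict_scalars ℝ <| ((contDiff_coord 1).pow a).sub
    ((((contDiff_coord 2).pow b).mul ((contDiff_coord 0).pow c)).add ((contDiff_coord 0).pow d))

theorem continuous_surfaceGrad : Continuous (surfaceGrad a b c d) := by
  unfold surfaceGrad
  fun_prop

theorem hasStrictFDerivAt_surfaceFn (p : C3) :
    HasStrictFDerivAt (surfaceFn a b c d)
      (hermitianFunctional (conj3 (surfaceGrad a b c d p))) p := by
  have h (i : Fin 3) : HasStrictFDerivAt (fun p : C3 => p i)
      (EuclideanSpace.proj i : C3 →L[ℂ] ℂ) p :=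
    (EuclideanSpace.proj i : C3 →L[ℂ] ℂ).hasStrictFDerivAt
  refine (((h 1).pow a).sub ((((h 2).pow b).mul ((h 0).pow c)).add
    ((h 0).pow d))).restrictScalars ℝ |>.congr_fderiv ?_
  ext v
  simp [surfaceGrad]
  ring

theorem fderiv_surfaceFn (p : C3) : fderiv ℝ (surfaceFn a b c d) p
    = hermitianFunctional (conj3 (surfaceGrad a b c d p)) :=
  (hasStrictFDerivAt_surfaceFn p).hasFDerivAt.fderiv

/-- At points of the axis the tangent projection keeps the `z`-component only. -/
theorem stratumProj_two (hΩ : IsOpen Ω) {q : C3} (hq : q ∈ zAxis ∩ Ω) (v : C3) :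
    stratumProj 2 (fun j => surfaceFiltration a b c d j ∩ Ω) 2 q v
      = EuclideanSpace.single 2 (v 2) := by
  have hker : tangentSpaceAt (zAxis ∩ Ω) q = planeProj.ker := by
    refine tangentSpaceAt_eq_ker planeProj.hasStrictFDerivAt planeProj_surjective ?_
      (mem_zAxis.1 hq.1)
    filter_upwards [hΩ.mem_nhds hq.2] with x hx
    rw [mem_inter_iff, mem_zAxis, and_iff_left hx]
  rw [stratumProj, layer_two, tangentProj_eq hker]
  apply Submodule.eq_starProjection_of_mem_of_inner_eq_zero
  · rw [LinearMap.mem_ker]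
    simp
  · intro w hw
    have hw' : (w 0, w 1) = (0 : ℂ × ℂ) := hw
    rw [Prod.mk_eq_zero] at hw'
    change ∑ i, inner ℝ (_ : ℂ) (w i) = 0
    simp [Fin.sum_univ_three, hw'.1, hw'.2]

/-- At points off the axis the tangent plane may be described by any nonzero multiple of the
gradient. -/
theorem stratumProj_four (hΩ : IsOpen Ω) {q : C3}
    (hq : q ∈ layer 2 (fun j => surfaceFiltration a b c d j ∩ Ω) 4) {n : C3} {μ : ℂ} (hμ : μ ≠ 0)
    (hn : n = μ • surfaceGrad a b c d q) (hn0 : n ≠ 0) :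
    stratumProj 2 (fun j => surfaceFiltration a b c d j ∩ Ω) 4 q
      = (hermitianFunctional (conj3 n)).ker.starProjection := by
  have hg : surfaceGrad a b c d q ≠ 0 := by rintro h; simp [hn, h] at hn0
  rw [stratumProj]
  rw [layer_four] at hq ⊢
  have hker : tangentSpaceAt ((surface a b c d ∩ Ω) \ (zAxis ∩ Ω)) q
      = (hermitianFunctional (conj3 (surfaceGrad a b c d q))).ker := by
    refine tangentSpaceAt_eq_ker (hasStrictFDerivAt_surfaceFn q)
      (hermitianFunctional_surjective (by simpa using hg)) ?_ (mem_surface _ _ _ _ |>.1 hq.1.1)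
    have hax : IsOpen (planeProj ⁻¹' {0}ᶜ) := isOpen_compl_singleton.preimage planeProj.continuous
    have hqa : q ∈ planeProj ⁻¹' {0}ᶜ := fun h => hq.2 ⟨mem_zAxis.2 h, hq.1.2⟩
    filter_upwards [hΩ.mem_nhds hq.1.2, hax.mem_nhds hqa] with x hx hxa
    rw [← mem_surface]
    exact ⟨fun h => h.1.1, fun h => ⟨⟨h, hx⟩, fun h' => hxa (mem_zAxis.1 h'.1)⟩⟩
  have hker' : (hermitianFunctional (conj3 (surfaceGrad a b c d q))).ker
      = (hermitianFunctional (conj3 n)).ker := by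
    ext v
    rw [LinearMap.mem_ker, LinearMap.mem_ker]
    change inner ℂ _ v = 0 ↔ inner ℂ _ v = 0
    rw [inner_conj3, inner_conj3, hn]
    simp only [PiLp.smul_apply, smul_eq_mul, mul_assoc]
    rw [← mul_add, ← mul_add, mul_eq_zero, or_iff_right hμ]
  exact tangentProj_eq (hker.trans hker')

end Layers

/-! ### The filtration is a stratification -/

section Stratification

variable {a b c d : ℕ}

theorem zAxis_subset_surface (ha : 0 < a) (hc : 0 < c) (hd : 0 < d) :
    zAxis ⊆ surface a b c d := by
  rintro p ⟨h0, h1⟩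
  change p 1 ^ a = p 2 ^ b * p 0 ^ c + p 0 ^ d
  simp [h0, h1, ha.ne', hc.ne', hd.ne']

theorem surfaceFiltration_eq_zAxis {j : ℕ} (hj : j ≠ 4) :
    surfaceFiltration a b c d j = zAxis := if_neg hj

theorem surfaceFiltration_four : surfaceFiltration a b c d 4 = surface a b c d := if_pos rfl

theorem surface_eq_zeros : surface a b c d = {p | ‖surfaceFn a b c d p‖ ^ 2 = 0} := by
  ext p
  rw [mem_surface]
  simp

theorem zAxis_eq_zeros : zAxis = {p : C3 | ‖p 0‖ ^ 2 + ‖p 1‖ ^ 2 = 0} := by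
  ext p
  rw [mem_ofPred_eq, add_eq_zero_iff_of_nonneg (sq_nonneg _) (sq_nonneg _)]
  simp [zAxis]

theorem contDiff_norm_sq_coord {n : WithTop ℕ∞} (i : Fin 3) :
    ContDiff ℝ n fun p : C3 => ‖p i‖ ^ 2 :=
  (contDiff_norm_sq ℝ).comp ((contDiff_coord i).restrict_scalars ℝ)

/-- Where the gradient does not vanish off the axis, the filtration is a stratification. -/
theorem isStratification_ball (ha : 0 < a) (hc : 0 < c) (hd : 0 < d) {r : ℝ} (hr : 0 < r)
    (hg : ∀ q ∈ surface a b c d, q ∉ zAxis → q ∈ Metric.ball (0 : C3) r →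
      surfaceGrad a b c d q ≠ 0) :
    IsStratification (Metric.ball (0 : C3) r) 2 4
      (fun j => surfaceFiltration a b c d j ∩ Metric.ball 0 r) where
  isOpen := Metric.isOpen_ball
  le := by norm_num
  nonempty := ⟨0, by simp [surfaceFiltration, zAxis], Metric.mem_ball_self hr⟩
  mono j _ hj := by
    refine inter_subset_inter_left _ ?_
    rw [surfaceFiltration_eq_zAxis hj.ne]
    by_cases h : j + 1 = 4
    · rw [h, surfaceFiltration_four]
      exact zAxis_subset_surface ha hc hd
    · rw [surfaceFiltration_eq_zAxis h]
  closed j _ _ := by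
    refine ⟨_, ?_, rfl⟩
    by_cases h : j = 4
    · rw [h, surfaceFiltration_four, surface_eq_zeros]
      exact isClosed_eq ((contDiff_surfaceFn (n := 0)).continuous.norm.pow 2) continuous_const
    · rw [surfaceFiltration_eq_zAxis h, zAxis_eq_zeros]
      exact isClosed_eq (by fun_prop) continuous_const
  subanalytic j _ _ := by
    by_cases h : j = 4
    · rw [h, surfaceFiltration_four, surface_eq_zeros]
      exact isSubanalyticIn_ball ((contDiff_norm_sq ℝ).comp contDiff_surfaceFn) r
    · rw [surfaceFiltration_eq_zAxis h, zAxis_eq_zeros]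
      exact isSubanalyticIn_ball
        ((contDiff_norm_sq_coord 0).add (contDiff_norm_sq_coord 1)) r
  smooth j h2 h4 := by
    obtain rfl | rfl | rfl : j = 2 ∨ j = 3 ∨ j = 4 := by omega
    · rw [layer_two]
      refine isSmoothSubmanifold_of_levelSet (G := ℂ × ℂ)
        (by rw [finrank_C3, Module.finrank_prod, Complex.finrank_real_complex]) fun p hp =>
        ⟨_, Metric.isOpen_ball, hp.2, planeProj, planeProj.contDiff, fun x _ => ?_, ?_⟩
      · rw [planeProj.fderiv]
        exact planeProj_surjective
      · rw [inter_assoc, inter_self]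
        ext x
        rw [mem_inter_iff, mem_zAxis, and_comm]
        rfl
    · rw [layer_three]
      exact fun p hp => hp.elim
    · rw [layer_four]
      refine isSmoothSubmanifold_of_levelSet (G := ℂ)
        (by rw [finrank_C3, Complex.finrank_real_complex]) fun p hp =>
        ⟨(Metric.ball 0 r ∩ planeProj ⁻¹' {0}ᶜ) ∩ surfaceGrad a b c d ⁻¹' {0}ᶜ,
          (Metric.isOpen_ball.inter (isOpen_compl_singleton.preimage planeProj.continuous)).inter
            (isOpen_compl_singleton.preimage continuous_surfaceGrad),
          ⟨⟨hp.1.2, fun h => hp.2 ⟨mem_zAxis.2 h, hp.1.2⟩⟩, hg p hp.1.1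
            (fun h => hp.2 ⟨h, hp.1.2⟩) hp.1.2⟩, surfaceFn a b c d, contDiff_surfaceFn,
          fun x hx => ?_, ?_⟩
      · rw [fderiv_surfaceFn]
        exact hermitianFunctional_surjective (by simpa using hx.2)
      · ext x
        constructor
        · rintro ⟨h, hW⟩
          exact ⟨hW, (mem_surface _ _ _ _).1 h.1.1⟩
        · rintro ⟨hW, h⟩
          exact ⟨⟨⟨(mem_surface _ _ _ _).2 h, hW.1.1⟩, fun h' => hW.1.2 (mem_zAxis.1 h'.1)⟩, hW⟩

end Stratification

/-! ### Chains and the distance to the axis -/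

section Chains

variable {a b c d : ℕ} {Ω : Set C3}

/-- A chain is either a single point of the axis, or a point off the axis followed by a point of
the axis: the layer of index `3` is empty. -/
theorem IsChain.cases {γ : ℝ} {r : ℕ} {j : ℕ → ℕ} {q : ℕ → C3}
    (h : IsChain γ 2 4 (fun j => surfaceFiltration a b c d j ∩ Ω) r j q) :
    (r = 0 ∧ j 0 = 2) ∨ (r = 1 ∧ j 0 = 4 ∧ j 1 = 2) := by
  have hne3 : ∀ s ≤ r, j s ≠ 3 := fun s hs h3 => by
    have := h.mem s hs
    rw [h3, layer_three] at this
    exact this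
  have hend : ∀ s ≤ r, j s = 2 → s = r := fun s hs h2 => by
    by_contra hsr
    have := (h.step s (by omega)).1
    simp only [mem_ofPred_eq, h2] at this
    omega
  have hstep : ∀ s < r, 2 ≤ j (s + 1) ∧ j (s + 1) < j s := fun s hs =>
    ⟨(h.step s hs).1.1, (h.step s hs).1.2.1⟩
  have h0 := h.start_mem
  have h3 := hne3 0 (Nat.zero_le r)
  obtain h2 | h4 : j 0 = 2 ∨ j 0 = 4 := by omega
  · exact Or.inl ⟨(hend 0 (Nat.zero_le r) h2).symm, h2⟩
  · have hr : 0 < r := by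
      rcases Nat.eq_zero_or_pos r with rfl | hr
      · have := h.last
        omega
      · exact hr
    have h1 := hstep 0 hr
    have h13 := hne3 1 hr
    have h12 : j 1 = 2 := by simp only [zero_add] at h1; omega
    exact Or.inr ⟨(hend 1 hr h12).symm, h4, h12⟩

theorem norm_coord_le_infDist {p : C3} (h : (zAxis ∩ Ω).Nonempty) {i : Fin 3} (hi : i ≠ 2) :
    ‖p i‖ ≤ Metric.infDist p (zAxis ∩ Ω) := by
  refine (Metric.le_infDist h).2 fun w hw => ?_
  have hwi : w i = 0 := by
    fin_cases i
    exacts [hw.1.1, hw.1.2, absurd rfl hi]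
  simpa [hwi, dist_eq_norm] using PiLp.norm_apply_le (p - w) i

theorem norm_sub_single_le (p : C3) : ‖p - EuclideanSpace.single 2 (p 2)‖ ≤ ‖p 0‖ + ‖p 1‖ := by
  rw [EuclideanSpace.norm_eq, Real.sqrt_le_left (by positivity)]
  simp [Fin.sum_univ_three]
  nlinarith [norm_nonneg (p 0), norm_nonneg (p 1)]

theorem single_mem_zAxis (w : ℂ) : EuclideanSpace.single 2 w ∈ zAxis := by
  simp [zAxis]

theorem single_mem_ball {p : C3} {r : ℝ} (hp : p ∈ Metric.ball (0 : C3) r) :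
    EuclideanSpace.single 2 (p 2) ∈ Metric.ball (0 : C3) r := by
  rw [mem_ball_zero_iff] at hp ⊢
  rw [PiLp.norm_single]
  exact (PiLp.norm_apply_le p 2).trans_lt hp

theorem infDist_zAxis_le {p : C3} {r : ℝ} (hp : p ∈ Metric.ball (0 : C3) r) :
    Metric.infDist p (zAxis ∩ Metric.ball 0 r) ≤ ‖p 0‖ + ‖p 1‖ := by
  have h : EuclideanSpace.single 2 (p 2) ∈ zAxis ∩ Metric.ball (0 : C3) r :=
    ⟨single_mem_zAxis _, single_mem_ball hp⟩
  refine (Metric.infDist_le_dist_of_mem h).trans ?_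
  rw [dist_eq_norm]
  exact norm_sub_single_le p

end Chains

/-! ### Failure of the bounds when a ≥ 2 and c < d -/

section Necessity

variable {a b c d : ℕ}

/-- At the points of the surface where `y = 0` and `z ^ b = -x ^ (d - c)` with `x ≠ 0`, the first
bound in the definition of a Lipschitz stratification forces `b ≤ C ((c + d) |z| + b |x|)`. -/
theorem le_of_chain_bound (ha : 2 ≤ a) (hb : 0 < b) (hc : 0 < c) (hcd : c < d) {γ : ℝ} (hγ : 1 < γ)
    {Ω : Set C3} (hΩ : IsOpen Ω) {C : ℝ}
    (hC : ∀ (r : ℕ) (j : ℕ → ℕ) (q : ℕ → C3),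
      IsChain γ 2 4 (fun j => surfaceFiltration a b c d j ∩ Ω) r j q → ∀ k, 1 ≤ k → k ≤ r →
      ‖(ContinuousLinearMap.id ℝ C3
          - stratumProj 2 (fun j => surfaceFiltration a b c d j ∩ Ω) (j 0) (q 0)).comp
          (chainProj 2 (fun j => surfaceFiltration a b c d j ∩ Ω) j q k)‖
        ≤ C * dist (q 0) (q 1)
          / distBelow 2 (fun j => surfaceFiltration a b c d j ∩ Ω) (j k) (q 0))
    {x z : ℂ} (hx : x ≠ 0) (hz : z ≠ 0) (hxz : z ^ b = -x ^ (d - c))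
    (hp : !₂[x, 0, z] ∈ Ω) (hp' : EuclideanSpace.single 2 z ∈ Ω) (hsmall : 2 * γ ^ 2 * ‖x‖ ≤ 1) :
    (b : ℝ) ≤ C * ((c + d) * ‖z‖ + b * ‖x‖) := by
  set p : C3 := !₂[x, 0, z] with hpdef
  set p' : C3 := EuclideanSpace.single 2 z with hp'def
  set S : ℕ → Set C3 := fun j => surfaceFiltration a b c d j ∩ Ω with hS
  have hX : 0 < ‖x‖ := norm_pos_iff.2 hx
  have hZ : 0 < ‖z‖ := norm_pos_iff.2 hz
  have hp'mem : p' ∈ zAxis ∩ Ω := ⟨single_mem_zAxis z, hp'⟩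
  have hdist : dist p p' = ‖x‖ := by
    rw [dist_eq_norm, EuclideanSpace.norm_eq]
    simp [hpdef, hp'def, Fin.sum_univ_three]
  have hδ : Metric.infDist p (zAxis ∩ Ω) = ‖x‖ := by
    refine le_antisymm ((Metric.infDist_le_dist_of_mem hp'mem).trans_eq hdist) ?_
    simpa [hpdef] using norm_coord_le_infDist (p := p) ⟨p', hp'mem⟩ (i := 0) (by decide)
  have hS2 : S 2 = zAxis ∩ Ω := by simp [hS, surfaceFiltration]
  have hS3 : S 3 = zAxis ∩ Ω := by simp [hS, surfaceFiltration]
  have hxd : x ^ d = x ^ (d - c) * x ^ c := by rw [← pow_add, Nat.sub_add_cancel hcd.le]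
  have hpV : p ∈ layer 2 S 4 := by
    rw [hS, layer_four]
    refine ⟨⟨?_, hp⟩, fun h => hx h.1.1⟩
    change (0 : ℂ) ^ a = z ^ b * x ^ c + x ^ d
    rw [zero_pow (by omega), hxz, hxd]
    ring
  have hchain : IsChain γ 2 4 S 1 (fun s => if s = 0 then 4 else 2)
      (fun s => if s = 0 then p else p') := by
    refine ⟨by simp, fun s hs => ?_, by simp, fun s hs => ?_, fun s h1 hs => ?_⟩
    · obtain rfl : s = 0 := by omega
      refine ⟨⟨le_rfl, by norm_num, ?_⟩, fun i hi => ?_⟩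
      · simp only [if_true, zero_add, one_ne_zero, if_false, hS2, hδ]
        simpa [distBelow] using hsmall
      · obtain ⟨h2, h4, hi⟩ := hi
        simp only [if_true] at h4 hi
        obtain rfl | rfl : i = 2 ∨ i = 3 := by omega
        · simp
        -- The index `3` is never admissible, since `d₃ = d₂ > 0` and `2 γ ^ 2 > 1`.
        · simp only [distBelow, hS3, hS2, hδ] at hi
          norm_num [hS2, hδ] at hi
          have h1 : 1 < γ ^ 2 := one_lt_pow₀ hγ two_ne_zero
          nlinarith [mul_lt_mul_of_pos_right h1 hX]
    · obtain rfl | rfl : s = 0 ∨ s = 1 := by omega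
      · simpa using hpV
      · simpa [hS, layer_two] using hp'mem
    · obtain rfl : s = 1 := by omega
      simp only [if_true, one_ne_zero, if_false, hS2, hδ, hdist]
      nlinarith
  have hbound := hC 1 _ _ hchain 1 le_rfl le_rfl
  simp only [if_true, one_ne_zero, if_false, hdist, chainProj, distBelow, zero_add, div_one,
    ContinuousLinearMap.id_comp] at hbound
  set P := stratumProj 2 S 4 p with hP
  set e : C3 := EuclideanSpace.single 2 1 with he
  have hnorm : ‖e - P e‖ ≤ C * ‖x‖ := by
    have h := (ContinuousLinearMap.le_opNorm _ e).trans
      (mul_le_mul_of_nonneg_right hbound (norm_nonneg e))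
    have h1 : stratumProj 2 S 2 p' e = e := by
      rw [hS, stratumProj_two hΩ hp'mem]
      simp [he]
    have h2 : ‖e‖ = 1 := by simp [he]
    rwa [ContinuousLinearMap.comp_apply, h1, h2, mul_one] at h
  -- The normal component of `e` is detected by the derivative of the defining function.
  have hker : inner ℂ (conj3 (surfaceGrad a b c d p)) (P e) = 0 := by
    have hmem : P e ∈ tangentSpaceAt (layer 2 S 4) p :=
      Submodule.starProjection_apply_mem _ e
    refine tangentSpaceAt_le_ker (hasStrictFDerivAt_surfaceFn p).hasFDerivAt ?_ ?_ hmem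
    · filter_upwards [self_mem_nhdsWithin] with w hw
      rw [hS, layer_four] at hw
      exact (mem_surface _ _ _ _).1 hw.1.1
    · rw [hS, layer_four] at hpV
      exact (mem_surface _ _ _ _).1 hpV.1.1
  obtain ⟨c, rfl⟩ : ∃ c', c = c' + 1 := ⟨c - 1, by omega⟩
  obtain ⟨b, rfl⟩ : ∃ b', b = b' + 1 := ⟨b - 1, by omega⟩
  -- The hypothesis on `z ^ b` makes the two terms of `f_x` have the same size.
  have hxd1 : ‖x‖ ^ (d - 1) = ‖z‖ ^ (b + 1) * ‖x‖ ^ c := by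
    have := congrArg norm hxz
    rw [norm_neg, norm_pow, norm_pow] at this
    rw [this, ← pow_add]
    congr 1
    omega
  have hg0 : ‖surfaceGrad a (b + 1) (c + 1) d p 0‖
      ≤ ((c + 1 : ℕ) + d) * (‖z‖ ^ (b + 1) * ‖x‖ ^ c) := by
    have : surfaceGrad a (b + 1) (c + 1) d p 0
        = -((c + 1 : ℕ) * z ^ (b + 1) * x ^ c + d * x ^ (d - 1)) := rfl
    rw [this, norm_neg]
    refine (norm_add_le _ _).trans (le_of_eq ?_)
    simp only [norm_mul, norm_pow, Complex.norm_natCast, hxd1]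
    ring
  have hg1 : surfaceGrad a (b + 1) (c + 1) d p 1 = 0 := by
    change (a : ℂ) * (0 : ℂ) ^ (a - 1) = 0
    rw [zero_pow (by omega), mul_zero]
  have hg2 : ‖surfaceGrad a (b + 1) (c + 1) d p 2‖ = (b + 1 : ℕ) * (‖z‖ ^ b * ‖x‖ ^ (c + 1)) := by
    have : surfaceGrad a (b + 1) (c + 1) d p 2 = -((b + 1 : ℕ) * z ^ b * x ^ (c + 1)) := rfl
    rw [this, norm_neg]
    simp only [norm_mul, norm_pow, Complex.norm_natCast]
    ring
  set w := e - P e with hw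
  have hpair : surfaceGrad a (b + 1) (c + 1) d p 2
      = surfaceGrad a (b + 1) (c + 1) d p 0 * w 0
        + surfaceGrad a (b + 1) (c + 1) d p 2 * w 2 := by
    have h := inner_conj3 (surfaceGrad a (b + 1) (c + 1) d p) w
    have h' : (inner ℂ (conj3 (surfaceGrad a (b + 1) (c + 1) d p)) w : ℂ)
        = surfaceGrad a (b + 1) (c + 1) d p 2 := by
      rw [hw, inner_sub_right, hker, inner_conj3]
      simp [he]
    rw [h', hg1, zero_mul, add_zero] at h
    exact h
  have hwn (i : Fin 3) : ‖w i‖ ≤ C * ‖x‖ := (PiLp.norm_apply_le w i).trans hnorm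
  have hmain := norm_add_le (surfaceGrad a (b + 1) (c + 1) d p 0 * w 0)
    (surfaceGrad a (b + 1) (c + 1) d p 2 * w 2)
  rw [← hpair, norm_mul, norm_mul] at hmain
  have hmain' := hmain.trans (add_le_add
    (mul_le_mul hg0 (hwn 0) (norm_nonneg _) (by positivity))
    (mul_le_mul_of_nonneg_left (hwn 2) (norm_nonneg _)))
  rw [hg2] at hmain'
  have hpos : 0 < ‖z‖ ^ b * ‖x‖ ^ (c + 1) := by positivity
  refine le_of_mul_le_mul_right (hmain'.trans (le_of_eq ?_)) hpos
  ring

/-- The germ is not a Lipschitz stratification when `a ≥ 2` and `c < d`: along the curve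
`(τ ^ b, 0, ζ τ ^ (d - c))` with `ζ ^ b = -1`, the tangent planes do not approach the direction of
the axis fast enough. -/
theorem not_isLipschitzStratificationGerm (ha : 2 ≤ a) (hb : 0 < b) (hc : 0 < c) (hcd : c < d)
    {γ : ℝ} (hγ : 1 < γ) :
    ¬ IsLipschitzStratificationGerm γ (0 : C3) 2 4 (surfaceFiltration a b c d) := by
  rintro ⟨Ω, hΩ, h0, -, C, -, hC⟩
  obtain ⟨ζ, hζ⟩ := IsAlgClosed.exists_pow_nat_eq (-1 : ℂ) hb
  have hζ0 : ζ ≠ 0 := by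
    rintro rfl
    simp [hb.ne'] at hζ
  have hm : d - c ≠ 0 := by omega
  have hxc : Continuous fun τ : ℝ => ((τ : ℂ) ^ b) := by fun_prop
  have hpc : Continuous fun τ : ℝ => (!₂[(τ : ℂ) ^ b, 0, ζ * (τ : ℂ) ^ (d - c)] : C3) := by
    fun_prop
  have hp'c : Continuous fun τ : ℝ =>
      (EuclideanSpace.single 2 (ζ * (τ : ℂ) ^ (d - c)) : C3) := by
    have h : Continuous fun τ : ℝ => (!₂[0, 0, ζ * (τ : ℂ) ^ (d - c)] : C3) := by fun_prop
    refine h.congr fun τ => ?_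
    ext i
    fin_cases i <;> simp
  have e1 : ∀ᶠ τ : ℝ in 𝓝 0, (!₂[(τ : ℂ) ^ b, 0, ζ * (τ : ℂ) ^ (d - c)] : C3) ∈ Ω := by
    refine hpc.tendsto 0 (hΩ.mem_nhds ?_)
    have h : (!₂[((0 : ℝ) : ℂ) ^ b, 0, ζ * ((0 : ℝ) : ℂ) ^ (d - c)] : C3) = 0 := by
      ext i
      fin_cases i <;> simp [hb.ne', hm]
    rwa [h]
  have e2 : ∀ᶠ τ : ℝ in 𝓝 0, (EuclideanSpace.single 2 (ζ * (τ : ℂ) ^ (d - c)) : C3) ∈ Ω := by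
    refine hp'c.tendsto 0 (hΩ.mem_nhds ?_)
    have h : (EuclideanSpace.single 2 (ζ * ((0 : ℝ) : ℂ) ^ (d - c)) : C3) = 0 := by
      ext i
      fin_cases i <;> simp [hm]
    rwa [h]
  have e3 : ∀ᶠ τ : ℝ in 𝓝 0, 2 * γ ^ 2 * ‖(τ : ℂ) ^ b‖ < 1 := by
    refine (continuous_const.mul hxc.norm).tendsto 0 |>.eventually_lt_const ?_
    simp [hb.ne']
  have hev : ∀ᶠ τ : ℝ in 𝓝[>] 0,
      (b : ℝ) ≤ C * ((c + d) * ‖ζ * (τ : ℂ) ^ (d - c)‖ + b * ‖(τ : ℂ) ^ b‖) := by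
    filter_upwards [nhdsWithin_le_nhds e1, nhdsWithin_le_nhds e2, nhdsWithin_le_nhds e3,
      self_mem_nhdsWithin] with τ h1 h2 h3 hτ
    have hτ0 : (τ : ℂ) ≠ 0 := by exact_mod_cast (ne_of_gt hτ)
    refine le_of_chain_bound ha hb hc hcd hγ hΩ (fun r j q h => (hC r j q h).1)
      (pow_ne_zero _ hτ0) (mul_ne_zero hζ0 (pow_ne_zero _ hτ0)) ?_ h1 h2 h3.le
    rw [mul_pow, hζ, ← pow_mul, ← pow_mul, mul_comm b]
    ring
  have hlim : Filter.Tendsto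
      (fun τ : ℝ => C * ((c + d) * ‖ζ * (τ : ℂ) ^ (d - c)‖ + b * ‖(τ : ℂ) ^ b‖))
      (𝓝[>] 0) (𝓝 0) := by
    have h : Continuous
        fun τ : ℝ => C * ((c + d) * ‖ζ * (τ : ℂ) ^ (d - c)‖ + b * ‖(τ : ℂ) ^ b‖) := by fun_prop
    have h' := (h.tendsto 0).mono_left (nhdsWithin_le_nhds (s := Ioi 0))
    simpa [hb.ne', hm] using h'
  have := ge_of_tendsto hlim hev
  have hb' : (0 : ℝ) < b := by exact_mod_cast hb
  linarith

end Necessity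

/-! ### Mostowski bounds from a normal field -/

section Sufficiency

variable {a b c d : ℕ}

/-- The three bounds in the definition of a Lipschitz stratification reduce to a *normal field*
`n`: a Lipschitz map, parallel to the gradient along the surface, whose norm is comparable from
below to the distance to the axis, and whose `z`-component `x * m` vanishes to second order along
the axis in the sense that `m` is Lipschitz and zero there. -/
theorem isLipschitzStratificationGerm_of_normalField (ha : 0 < a) (hc : 0 < c) (hd : 0 < d) {γ : ℝ}
    (hγ : 1 < γ) {n : C3 → C3} {m : C3 → ℂ} (hn : ContDiff ℝ 1 n) (hm : ContDiff ℝ 1 m)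
    (hm0 : ∀ p ∈ zAxis, m p = 0) (hz : ∀ p, n p 2 = p 0 * m p) {κ : ℝ} (hκ : 0 < κ)
    (h : ∀ᶠ q in 𝓝 (0 : C3), q ∈ surface a b c d → q ∉ zAxis →
      (∃ μ : ℂ, μ ≠ 0 ∧ n q = μ • surfaceGrad a b c d q) ∧ κ * (‖q 0‖ + ‖q 1‖) ≤ ‖n q‖) :
    IsLipschitzStratificationGerm γ (0 : C3) 2 4 (surfaceFiltration a b c d) := by
  obtain ⟨K₁, t₁, ht₁, hK₁⟩ := (hn.contDiffAt (x := 0)).exists_lipschitzOnWith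
  obtain ⟨K₂, t₂, ht₂, hK₂⟩ := (hm.contDiffAt (x := 0)).exists_lipschitzOnWith
  obtain ⟨r, hr, hball⟩ := Metric.mem_nhds_iff.1 (Filter.inter_mem (Filter.inter_mem ht₁ ht₂) h)
  set Ω : Set C3 := Metric.ball 0 r with hΩ
  have hΩo : IsOpen Ω := Metric.isOpen_ball
  set L : ℝ := max K₁ K₂ with hL
  have hL0 : 0 ≤ L := le_max_of_le_left K₁.2
  have hnL : ∀ p ∈ Ω, ∀ p' ∈ Ω, ‖n p - n p'‖ ≤ L * dist p p' := fun p hp p' hp' => by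
    rw [← dist_eq_norm]
    exact (hK₁.dist_le_mul p (hball hp).1.1 p' (hball hp').1.1).trans
      (mul_le_mul_of_nonneg_right (le_max_left _ _) dist_nonneg)
  have hmL : ∀ p ∈ Ω, ∀ p' ∈ Ω, ‖m p - m p'‖ ≤ L * dist p p' := fun p hp p' hp' => by
    rw [← dist_eq_norm]
    exact (hK₂.dist_le_mul p (hball hp).1.2 p' (hball hp').1.2).trans
      (mul_le_mul_of_nonneg_right (le_max_right _ _) dist_nonneg)
  set S : ℕ → Set C3 := fun j => surfaceFiltration a b c d j ∩ Ω with hS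
  have hne : (zAxis ∩ Ω).Nonempty :=
    ⟨0, by simp [zAxis], Metric.mem_ball_self hr⟩
  set δ : C3 → ℝ := fun p => Metric.infDist p (zAxis ∩ Ω) with hδ
  have hx : ∀ p, ‖p 0‖ ≤ δ p := fun p => norm_coord_le_infDist hne (by decide)
  have hy : ∀ p, ‖p 1‖ ≤ δ p := fun p => norm_coord_le_infDist hne (by decide)
  have hlayer : ∀ q ∈ layer 2 S 4, q ∈ surface a b c d ∧ q ∉ zAxis ∧ q ∈ Ω := fun q hq => by
    rw [hS, layer_four] at hq
    exact ⟨hq.1.1, fun h' => hq.2 ⟨h', hq.1.2⟩, hq.1.2⟩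
  have hδpos : ∀ q ∈ layer 2 S 4, 0 < δ q := fun q hq => by
    by_contra hcon
    refine (hlayer q hq).2.1 ⟨?_, ?_⟩
    · exact norm_le_zero_iff.1 ((hx q).trans (not_lt.1 hcon))
    · exact norm_le_zero_iff.1 ((hy q).trans (not_lt.1 hcon))
  have hnorm : ∀ q ∈ layer 2 S 4, κ * δ q ≤ ‖n q‖ := fun q hq => by
    obtain ⟨h1, h2, h3⟩ := hlayer q hq
    exact (mul_le_mul_of_nonneg_left (infDist_zAxis_le h3) hκ.le).trans ((hball h3).2 h1 h2).2
  have hn0 : ∀ q ∈ layer 2 S 4, n q ≠ 0 := fun q hq h0 => by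
    have := hnorm q hq
    rw [h0, norm_zero] at this
    exact absurd this (not_le.2 (mul_pos hκ (hδpos q hq)))
  have hN0 : ∀ q ∈ layer 2 S 4, conj3 (n q) ≠ 0 := fun q hq => by simpa using hn0 q hq
  have hP : ∀ q ∈ layer 2 S 4,
      stratumProj 2 S 4 q = (hermitianFunctional (conj3 (n q))).ker.starProjection :=
    fun q hq => by
      obtain ⟨h1, h2, h3⟩ := hlayer q hq
      obtain ⟨μ, hμ, hμn⟩ := ((hball h3).2 h1 h2).1
      exact stratumProj_four hΩo hq hμ hμn (hn0 q hq)
  -- `m` is compared with its value `0` at the projection of `q` to the axis, which lies in the ball.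
  have hmδ : ∀ q ∈ Ω, ‖m q‖ ≤ 2 * L * δ q := fun q hq => by
    have h1 := hmL q hq _ (single_mem_ball hq)
    rw [hm0 _ (single_mem_zAxis _), sub_zero, dist_eq_norm] at h1
    refine h1.trans ?_
    have h2 := (norm_sub_single_le q).trans (add_le_add (hx q) (hy q))
    nlinarith [mul_le_mul_of_nonneg_left h2 hL0]
  have hinner : ∀ q w, (inner ℂ (conj3 (n q)) (EuclideanSpace.single 2 w) : ℂ) = n q 2 * w :=
    fun q w => by simp
  have hnz : ∀ q ∈ Ω, ‖n q 2‖ ≤ 2 * L * δ q ^ 2 := fun q hq => by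
    rw [hz, norm_mul]
    refine (mul_le_mul (hx q) (hmδ q hq) (norm_nonneg _) ?_).trans_eq (by ring)
    exact Metric.infDist_nonneg
  -- Facts about a pair of neighbouring points.
  have hpair : ∀ q ∈ layer 2 S 4, ∀ q' ∈ layer 2 S 4, dist q q' ≤ 1 / (2 * γ) * δ q →
      δ q / 2 ≤ δ q' ∧ ‖n q 2 - n q' 2‖ ≤ 4 * L * δ q * dist q q' := fun q hq q' hq' hqq => by
    have hδ0 := hδpos q hq
    have h2 : dist q q' ≤ δ q / 2 := by
      refine hqq.trans ?_
      rw [div_mul_eq_mul_div, one_mul]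
      exact div_le_div_of_nonneg_left hδ0.le two_pos (by linarith)
    have h3 : δ q ≤ δ q' + dist q q' := Metric.infDist_le_infDist_add_dist
    have hxx : ‖q 0 - q' 0‖ ≤ dist q q' := by
      simpa [dist_eq_norm] using PiLp.norm_apply_le (q - q') 0
    have hx' : ‖q' 0‖ ≤ 2 * δ q := by
      have := norm_sub_norm_le (q' 0) (q 0)
      rw [norm_sub_rev] at this
      linarith [hx q]
    refine ⟨by linarith, ?_⟩
    have hid : n q 2 - n q' 2 = (q 0 - q' 0) * m q + q' 0 * (m q - m q') := by
      rw [hz, hz]; ring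
    rw [hid]
    refine (norm_add_le _ _).trans ?_
    rw [norm_mul, norm_mul]
    refine (add_le_add
      (mul_le_mul hxx (hmδ q (hlayer q hq).2.2) (norm_nonneg _) dist_nonneg)
      (mul_le_mul hx' (hmL q (hlayer q hq).2.2 q' (hlayer q' hq').2.2) (norm_nonneg _)
        (by positivity))).trans (le_of_eq ?_)
    ring
  refine ⟨Ω, hΩo, Metric.mem_ball_self hr, isStratification_ball ha hc hd hr fun q h1 h2 h3 h0 => ?_,
    8 * L / κ + 4 * (L / κ) ^ 2 + 1, by positivity, fun N j q hch => ?_⟩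
  · have hq : q ∈ layer 2 S 4 := by
      rw [hS, layer_four]
      exact ⟨⟨h1, h3⟩, fun h' => h2 h'.1⟩
    obtain ⟨μ, -, hμn⟩ := ((hball h3).2 h1 h2).1
    rw [h0, smul_zero] at hμn
    exact hn0 q hq hμn
  have hLκ : 0 ≤ L / κ := div_nonneg hL0 hκ.le
  rcases hch.cases with ⟨rfl, hj⟩ | ⟨rfl, hj0, hj1⟩
  · refine ⟨fun k h1 h2 => by omega, fun q' hq' hqq => ⟨fun k h1 h2 => by omega, ?_⟩⟩
    have hq0 := hch.mem 0 le_rfl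
    rw [hj, layer_two] at hq0 hq'
    have h0 : stratumProj 2 S (j 0) (q 0) - stratumProj 2 S (j 0) q' = 0 := by
      ext1 v
      rw [hj, sub_apply, stratumProj_two hΩo hq0, stratumProj_two hΩo hq',
        sub_self, zero_apply]
    rw [h0, norm_zero, hj, distBelow, if_pos rfl, div_one]
    positivity
  · have hq0 := hch.mem 0 (Nat.zero_le _)
    have hq1 := hch.mem 1 le_rfl
    rw [hj0] at hq0
    rw [hj1, layer_two] at hq1
    have hδ0 := hδpos _ hq0
    have hnq := hnorm _ hq0
    have hnpos : 0 < ‖n (q 0)‖ := norm_pos_iff.2 (hn0 _ hq0)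
    -- The projection to the axis keeps only the `z`-component, so that operator norms of composites
    -- with it are tested on multiples of the unit vector along the axis.
    have hchain : ∀ T : C3 →L[ℝ] C3, ∀ B : ℝ, 0 ≤ B →
        (∀ w : ℂ, ‖T (EuclideanSpace.single 2 w)‖ ≤ B * ‖w‖) → ∀ k, 1 ≤ k → k ≤ 1 →
        ‖T.comp (chainProj 2 S j q k)‖ ≤ B / distBelow 2 S (j k) (q 0) := by
      intro T B hB hT k h1 h2
      obtain rfl : k = 1 := le_antisymm h2 h1
      rw [hj1, distBelow, if_pos rfl, div_one]
      refine ContinuousLinearMap.opNorm_le_bound _ hB fun v => ?_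
      have hv : chainProj 2 S j q 1 v = EuclideanSpace.single 2 (v 2) := by
        simp only [chainProj, zero_add, ContinuousLinearMap.id_comp, hj1]
        exact stratumProj_two hΩo hq1 v
      rw [ContinuousLinearMap.comp_apply, hv]
      exact (hT _).trans (mul_le_mul_of_nonneg_left (PiLp.norm_apply_le v 2) hB)
    have hdB : distBelow 2 S (j 0) (q 0) = δ (q 0) := by
      rw [hj0]
      simp [distBelow, hS, hδ, surfaceFiltration]
    refine ⟨hchain _ _ (by positivity) fun w => ?_, fun q' hq' hqq => ?_⟩
    · rw [hj0, hP _ hq0, sub_apply, ContinuousLinearMap.id_apply,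
        norm_sub_starProjection_ker (hN0 _ hq0), hinner, norm_mul, LinearIsometryEquiv.norm_map,
        div_le_iff₀ hnpos]
      have hδd : δ (q 0) ≤ dist (q 0) (q 1) := Metric.infDist_le_dist_of_mem hq1
      have h1 : ‖n (q 0) 2‖ ≤ 8 * L / κ * dist (q 0) (q 1) * ‖n (q 0)‖ := by
        calc ‖n (q 0) 2‖ ≤ 2 * L * δ (q 0) ^ 2 := hnz _ (hlayer _ hq0).2.2
          _ ≤ 8 * L * δ (q 0) ^ 2 := by gcongr; norm_num
          _ = 8 * L / κ * δ (q 0) * (κ * δ (q 0)) := by field_simp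
          _ ≤ _ := by gcongr
      calc ‖n (q 0) 2‖ * ‖w‖ ≤ 8 * L / κ * dist (q 0) (q 1) * ‖n (q 0)‖ * ‖w‖ := by gcongr
        _ ≤ (8 * L / κ + 4 * (L / κ) ^ 2 + 1) * dist (q 0) (q 1) * ‖n (q 0)‖ * ‖w‖ := by
          gcongr
          nlinarith [sq_nonneg (L / κ)]
        _ = _ := by ring
    · rw [hj0] at hq'
      rw [hdB] at hqq
      obtain ⟨hδ', hnz'⟩ := hpair _ hq0 _ hq' hqq
      have hnq' : κ * δ (q 0) / 2 ≤ ‖n q'‖ := by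
        refine le_trans ?_ (hnorm _ hq')
        rw [mul_div_assoc]
        exact mul_le_mul_of_nonneg_left hδ' hκ.le
      have hnpos' : 0 < ‖n q'‖ := norm_pos_iff.2 (hn0 _ hq')
      have hNd : ‖conj3 (n (q 0)) - conj3 (n q')‖ ≤ L * dist (q 0) q' := by
        rw [← map_sub, LinearIsometryEquiv.norm_map]
        exact hnL _ (hlayer _ hq0).2.2 _ (hlayer _ hq').2.2
      have hdiff := norm_starProjection_ker_sub_le (hN0 _ hq0) (hN0 _ hq')
      simp only [LinearIsometryEquiv.norm_map] at hdiff
      refine ⟨hchain _ _ (by positivity) fun w => ?_, ?_⟩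
      · rw [hj0, hP _ hq0, hP _ hq', sub_apply]
        refine (hdiff _).trans ?_
        rw [hinner, hinner, ← sub_mul, norm_mul, norm_mul]
        have h1 : ‖n (q 0) 2 - n q' 2‖ * ‖w‖ / ‖n q'‖
            ≤ 4 * L * δ (q 0) * dist (q 0) q' * ‖w‖ / (κ * δ (q 0) / 2) := by gcongr
        have h2 : ‖n (q 0) 2‖ * ‖w‖
              * (‖conj3 (n (q 0)) - conj3 (n q')‖ / (‖n (q 0)‖ * ‖n q'‖))
            ≤ 2 * L * δ (q 0) ^ 2 * ‖w‖
              * (L * dist (q 0) q' / (κ * δ (q 0) * (κ * δ (q 0) / 2))) := by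
          have := hnz _ (hlayer _ hq0).2.2
          gcongr
        refine (add_le_add h1 h2).trans ?_
        have h3 : 4 * L * δ (q 0) * dist (q 0) q' * ‖w‖ / (κ * δ (q 0) / 2)
            + 2 * L * δ (q 0) ^ 2 * ‖w‖
              * (L * dist (q 0) q' / (κ * δ (q 0) * (κ * δ (q 0) / 2)))
            = (8 * L / κ + 4 * (L / κ) ^ 2) * dist (q 0) q' * ‖w‖ := by
          have := hδ0.ne'
          field_simp
          ring
        rw [h3]
        exact mul_le_mul_of_nonneg_right
          (mul_le_mul_of_nonneg_right (by linarith) dist_nonneg) (norm_nonneg _)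
      · rw [hdB, hj0, hP _ hq0, hP _ hq']
        refine ContinuousLinearMap.opNorm_le_bound _ (by positivity) fun v => ?_
        rw [sub_apply]
        refine (hdiff v).trans ?_
        rw [← inner_sub_left]
        have hcs : ‖(inner ℂ (conj3 (n (q 0))) v : ℂ)‖ ≤ ‖n (q 0)‖ * ‖v‖ := by
          simpa using norm_inner_le_norm (𝕜 := ℂ) (conj3 (n (q 0))) v
        have h1 : ‖(inner ℂ (conj3 (n (q 0)) - conj3 (n q')) v : ℂ)‖ / ‖n q'‖
            ≤ L * dist (q 0) q' * ‖v‖ / (κ * δ (q 0) / 2) := by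
          have := norm_inner_le_norm (𝕜 := ℂ) (conj3 (n (q 0)) - conj3 (n q')) v
          have := this.trans (mul_le_mul_of_nonneg_right hNd (norm_nonneg v))
          gcongr
        have h2 : ‖(inner ℂ (conj3 (n (q 0))) v : ℂ)‖
              * (‖conj3 (n (q 0)) - conj3 (n q')‖ / (‖n (q 0)‖ * ‖n q'‖))
            ≤ L * dist (q 0) q' * ‖v‖ / (κ * δ (q 0) / 2) := by
          calc _ ≤ ‖n (q 0)‖ * ‖v‖ * (L * dist (q 0) q' / (‖n (q 0)‖ * ‖n q'‖)) := by gcongr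
            _ = L * dist (q 0) q' * ‖v‖ / ‖n q'‖ := by field_simp
            _ ≤ _ := by gcongr
        refine (add_le_add h1 h2).trans ?_
        have h3 : L * dist (q 0) q' * ‖v‖ / (κ * δ (q 0) / 2)
            + L * dist (q 0) q' * ‖v‖ / (κ * δ (q 0) / 2)
            = 4 * L / κ * dist (q 0) q' / δ (q 0) * ‖v‖ := by
          have := hδ0.ne'
          field_simp
          ring
        rw [h3]
        gcongr
        have h4 : 4 * L / κ = 4 * (L / κ) := by ring
        have h8 : 8 * L / κ = 8 * (L / κ) := by ring
        rw [h4, h8]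
        nlinarith [sq_nonneg (L / κ)]

end Sufficiency

/-! ### Normal fields on the surface -/

section NormalFields

variable {a b c d : ℕ}

theorem contDiff_vec3 {n : WithTop ℕ∞} {f g h : C3 → ℂ} (hf : ContDiff ℂ n f) (hg : ContDiff ℂ n g)
    (hh : ContDiff ℂ n h) : ContDiff ℝ n fun p => (!₂[f p, g p, h p] : C3) := by
  refine ContDiff.restrict_scalars ℝ (contDiff_euclidean.2 fun i => ?_)
  fin_cases i
  exacts [hf, hg, hh]

theorem coord_sum_le {p : C3} {κ : ℝ} {v : C3} (h0 : 2 * κ * ‖p 1‖ ≤ ‖v 0‖)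
    (h1 : 2 * κ * ‖p 0‖ ≤ ‖v 1‖) : κ * (‖p 0‖ + ‖p 1‖) ≤ ‖v‖ := by
  have h2 := PiLp.norm_apply_le v 0
  have h3 := PiLp.norm_apply_le v 1
  linarith

/-- For `a = 1` the surface is the graph of `z ^ b * x ^ c + x ^ d`, and `x` times the gradient is a
normal field. -/
theorem isLipschitzStratificationGerm_of_graph (hc : 0 < c) (hd : 0 < d) {γ : ℝ} (hγ : 1 < γ) :
    IsLipschitzStratificationGerm γ (0 : C3) 2 4 (surfaceFiltration 1 b c d) := by
  refine isLipschitzStratificationGerm_of_normalField (κ := 1 / 3)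
    (n := fun p => !₂[-(c * p 2 ^ b * p 0 ^ c + d * p 0 ^ d), p 0,
      p 0 * -(b * p 2 ^ (b - 1) * p 0 ^ c)])
    (m := fun p => -(b * p 2 ^ (b - 1) * p 0 ^ c)) one_pos hc hd hγ ?_ ?_ ?_ (fun p => rfl)
    (by norm_num) ?_
  · refine contDiff_vec3 ?_ (contDiff_coord 0) ?_ <;>
    · have := contDiff_coord (n := 1) 0
      have := contDiff_coord (n := 1) 2
      fun_prop
  · refine ContDiff.restrict_scalars ℝ (𝕜' := ℂ) ?_
    have := contDiff_coord (n := 1) 0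
    have := contDiff_coord (n := 1) 2
    fun_prop
  · rintro p ⟨h0, -⟩
    simp [h0, hc.ne']
  · filter_upwards [Metric.ball_mem_nhds (0 : C3) one_pos] with q hq hqV hqa
    rw [mem_ball_zero_iff] at hq
    have hV : q 1 = q 2 ^ b * q 0 ^ c + q 0 ^ d := by
      have h : q 1 ^ 1 = _ := hqV
      rwa [pow_one] at h
    have hx1 : ‖q 0‖ ≤ 1 := (PiLp.norm_apply_le q 0).trans hq.le
    have hz1 : ‖q 2‖ ≤ 1 := (PiLp.norm_apply_le q 2).trans hq.le
    have hx : q 0 ≠ 0 := fun h0 => hqa ⟨h0, by rw [hV, h0]; simp [hc.ne', hd.ne']⟩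
    refine ⟨⟨q 0, hx, ?_⟩, ?_⟩
    · obtain ⟨c, rfl⟩ : ∃ c', c = c' + 1 := ⟨c - 1, by omega⟩
      obtain ⟨d, rfl⟩ : ∃ d', d = d' + 1 := ⟨d - 1, by omega⟩
      ext i
      fin_cases i
      · simp [surfaceGrad]; ring
      · simp [surfaceGrad]
      · simp [surfaceGrad]
    · have hy : ‖q 1‖ ≤ 2 * ‖q 0‖ := by
        rw [hV]
        refine (norm_add_le _ _).trans ?_
        rw [norm_mul, norm_pow, norm_pow, norm_pow, two_mul]
        have h1 := pow_le_of_le_one (norm_nonneg (q 0)) hx1 hc.ne'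
        have h2 := pow_le_of_le_one (norm_nonneg (q 0)) hx1 hd.ne'
        have h3 : ‖q 2‖ ^ b ≤ 1 := pow_le_one₀ (norm_nonneg _) hz1
        refine add_le_add ?_ h2
        calc ‖q 2‖ ^ b * ‖q 0‖ ^ c ≤ 1 * ‖q 0‖ := by gcongr
          _ = ‖q 0‖ := one_mul _
      refine le_trans ?_ (PiLp.norm_apply_le _ 1)
      change 1 / 3 * (‖q 0‖ + ‖q 1‖) ≤ ‖q 0‖
      linarith

/-- For `d ≤ c` the surface is `y ^ a = x ^ d * (1 + t)` with `t = z ^ b * x ^ (c - d)`. On it the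
gradient, multiplied by `x * y / x ^ d`, extends to a polynomial normal field. -/
theorem isLipschitzStratificationGerm_of_le (ha : 0 < a) (hb : 0 < b) (hd : 0 < d) (hdc : d ≤ c)
    {γ : ℝ} (hγ : 1 < γ) :
    IsLipschitzStratificationGerm γ (0 : C3) 2 4 (surfaceFiltration a b c d) := by
  have hc : 0 < c := hd.trans_le hdc
  refine isLipschitzStratificationGerm_of_normalField (κ := 1 / 4)
    (n := fun p => !₂[-(p 1 * (d + c * (p 2 ^ b * p 0 ^ (c - d)))),
      a * p 0 * (1 + p 2 ^ b * p 0 ^ (c - d)),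
      p 0 * -(b * p 1 * p 2 ^ (b - 1) * p 0 ^ (c - d))])
    (m := fun p => -(b * p 1 * p 2 ^ (b - 1) * p 0 ^ (c - d))) ha hc hd hγ ?_ ?_ ?_ (fun p => rfl)
    (by norm_num) ?_
  · have := contDiff_coord (n := 1) 0
    have := contDiff_coord (n := 1) 1
    have := contDiff_coord (n := 1) 2
    refine contDiff_vec3 ?_ ?_ ?_ <;> fun_prop
  · refine ContDiff.restrict_scalars ℝ (𝕜' := ℂ) ?_
    have := contDiff_coord (n := 1) 0
    have := contDiff_coord (n := 1) 1
    have := contDiff_coord (n := 1) 2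
    fun_prop
  · rintro p ⟨-, h1⟩
    simp [h1]
  · have hc' : (0 : ℝ) < c := by exact_mod_cast hc
    have hc1 : (1 : ℝ) ≤ c := by exact_mod_cast hc
    have hd1 : (1 : ℝ) ≤ d := by exact_mod_cast hd
    have ha1 : (1 : ℝ) ≤ a := by exact_mod_cast ha
    -- On this ball `|c t| ≤ 1 / 2`, so that `d + c t` and `1 + t` are bounded away from zero.
    filter_upwards [Metric.ball_mem_nhds (0 : C3) (show (0 : ℝ) < 1 / (2 * c) by positivity)]
      with q hq hqV hqa
    rw [mem_ball_zero_iff] at hq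
    have hq1 : 1 / (2 * (c : ℝ)) ≤ 1 := by
      rw [div_le_one (by positivity)]
      linarith
    have hx1 : ‖q 0‖ ≤ 1 := (PiLp.norm_apply_le q 0).trans (hq.le.trans hq1)
    have hz2 : ‖q 2‖ ≤ 1 / (2 * c) := (PiLp.norm_apply_le q 2).trans hq.le
    set t : ℂ := q 2 ^ b * q 0 ^ (c - d) with ht
    have htn : ‖t‖ ≤ 1 / (2 * c) := by
      rw [ht, norm_mul, norm_pow, norm_pow]
      have h1 := pow_le_of_le_one (norm_nonneg (q 2)) (hz2.trans hq1) hb.ne'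
      have h2 : ‖q 0‖ ^ (c - d) ≤ 1 := pow_le_one₀ (norm_nonneg _) hx1
      calc ‖q 2‖ ^ b * ‖q 0‖ ^ (c - d) ≤ ‖q 2‖ * 1 := by gcongr
        _ ≤ _ := by rwa [mul_one]
    have hct : ‖(c : ℂ) * t‖ ≤ 1 / 2 := by
      rw [norm_mul, Complex.norm_natCast]
      calc (c : ℝ) * ‖t‖ ≤ c * (1 / (2 * c)) := by gcongr
        _ = 1 / 2 := by field_simp
    have ht2 : ‖t‖ ≤ 1 / 2 := by
      refine le_trans ?_ hct
      rw [norm_mul (c : ℂ) t, Complex.norm_natCast]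
      exact le_mul_of_one_le_left (norm_nonneg _) hc1
    have hu1 : 1 / 2 ≤ ‖1 + t‖ := by
      have := norm_sub_le_norm_add (1 : ℂ) t
      rw [norm_one] at this
      linarith
    have hu2 : 1 / 2 ≤ ‖(d : ℂ) + c * t‖ := by
      have := norm_sub_le_norm_add (d : ℂ) (c * t)
      rw [Complex.norm_natCast] at this
      linarith
    have hV : q 1 ^ a = q 0 ^ d * (1 + t) := by
      have h : q 1 ^ a = q 2 ^ b * q 0 ^ c + q 0 ^ d := hqV
      have hcd : q 0 ^ c = q 0 ^ (c - d) * q 0 ^ d := by rw [← pow_add, Nat.sub_add_cancel hdc]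
      rw [h, hcd, ht]
      ring
    have hu0 : 1 + t ≠ 0 := fun h => by rw [h, norm_zero] at hu1; norm_num at hu1
    have hx : q 0 ≠ 0 := fun h0 => hqa ⟨h0, by
      rw [h0, zero_pow hd.ne', zero_mul] at hV
      exact pow_eq_zero_iff ha.ne' |>.1 hV⟩
    have hy : q 1 ≠ 0 := fun h0 => by
      rw [h0, zero_pow ha.ne'] at hV
      exact mul_ne_zero (pow_ne_zero _ hx) hu0 hV.symm
    refine ⟨⟨q 0 * q 1 / q 0 ^ d, by positivity, ?_⟩, coord_sum_le ?_ ?_⟩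
    · have hxd := pow_ne_zero d hx
      obtain ⟨e, rfl⟩ : ∃ e, c = d + e := ⟨c - d, by omega⟩
      obtain ⟨d, rfl⟩ : ∃ d', d = d' + 1 := ⟨d - 1, by omega⟩
      obtain ⟨a, rfl⟩ : ∃ a', a = a' + 1 := ⟨a - 1, by omega⟩
      rw [Nat.add_sub_cancel_left] at ht
      have hsub : d + 1 + e - 1 = d + e := by omega
      ext i
      fin_cases i
      · change -(q 1 * (((d + 1 : ℕ) : ℂ) + (d + 1 + e : ℕ) * t)) = q 0 * q 1 / q 0 ^ (d + 1)
          * -((d + 1 + e : ℕ) * q 2 ^ b * q 0 ^ (d + 1 + e - 1) + (d + 1 : ℕ) * q 0 ^ (d + 1 - 1))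
        rw [ht, hsub, Nat.add_sub_cancel]
        field_simp
        ring
      · change (a + 1 : ℕ) * q 0 * (1 + t) = q 0 * q 1 / q 0 ^ (d + 1)
          * ((a + 1 : ℕ) * q 1 ^ (a + 1 - 1))
        rw [Nat.add_sub_cancel]
        have h : 1 + t = q 1 ^ (a + 1) / q 0 ^ (d + 1) := by rw [hV]; field_simp
        rw [h]
        ring
      · change q 0 * -(b * q 1 * q 2 ^ (b - 1) * q 0 ^ (d + 1 + e - (d + 1)))
          = q 0 * q 1 / q 0 ^ (d + 1) * -(b * q 2 ^ (b - 1) * q 0 ^ (d + 1 + e))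
        rw [Nat.add_sub_cancel_left]
        field_simp
        ring
    · change 2 * (1 / 4) * ‖q 1‖ ≤ ‖-(q 1 * (d + c * t))‖
      rw [norm_neg, norm_mul]
      nlinarith [norm_nonneg (q 1)]
    · change 2 * (1 / 4) * ‖q 0‖ ≤ ‖a * q 0 * (1 + t)‖
      rw [norm_mul, norm_mul, Complex.norm_natCast]
      calc 2 * (1 / 4) * ‖q 0‖ = 1 * ‖q 0‖ * (1 / 2) := by ring
        _ ≤ a * ‖q 0‖ * ‖1 + t‖ := by gcongr

end NormalFields

end Mostowski

end

theorem mainTheorem8 (a b c d : ℕ) (ha : 0 < a) (hb : 0 < b) (hc : 0 < c) (hd : 0 < d)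
    (γ : ℝ) (hγ : 1 < γ) :
    Mostowski.IsLipschitzStratificationGerm γ (0 : Mostowski.C3) 2 4
        (Mostowski.surfaceFiltration a b c d) ↔
      (a = 1 ∨ d ≤ c) := by
  constructor
  · intro h
    by_contra! hcon
    exact Mostowski.not_isLipschitzStratificationGerm (by omega) hb hc hcon.2 hγ h
  · rintro (rfl | hdc)
    · exact Mostowski.isLipschitzStratificationGerm_of_graph hc hd hγ
    · exact Mostowski.isLipschitzStratificationGerm_of_le ha hb hd hdc hγ
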